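/- Let $\mathfrak H$ be a complex Hilbert space (inner product linear in the second variable), and let $\mathfrak a$ be a symmetric sesquilinear form with dense domain $\mathrm{Dom}[\mathfrak a]\subset\mathfrak H$. Let $J$ be a self-adjoint involution on $\mathfrak H$ ($J=J^*$, $J^2=I$) such that $J\,\mathrm{Dom}[\mathfrak a]=\mathrm{Dom}[\mathfrak a]$ and $\mathfrak a[Jx,y]=\mathfrak a[x,Jy]$ for all $x,y\in\mathrm{Dom}[\mathfrak a]$. Suppose that the form $\mathfrak a_J[x,y]:=\mathfrak a[x,Jy]$ on $\mathrm{Dom}[\mathfrak a_J]=\mathrm{Dom}[\mathfrak a]$ is closed and positive definite, that is, it is symmetric and there is $c>0$ with $\mathfrak a_J[x]\ge c\|x\|^2$ for all $x\in\mathrm{Dom}[\mathfrak a]$, where $\mathfrak s[x]:=\mathfrak s[x,x]$ for a form $\mathfrak s$. Put $\mathfrak H_\pm=\mathrm{Ran}(I\pm J)$, and let $$m_\pm=\inf\left\{\frac{\mathfrak a_J[x]}{\|x\|^2} : 0\ne x\in \mathfrak H_\pm\cap\mathrm{Dom}[\mathfrak a]\right\}\in(0,\infty]$$ be the greatest lower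 bound of $\mathfrak a_J$ on $\mathfrak H_\pm$ (with $\inf\emptyset=+\infty$). Let $\mathfrak v$ be a symmetric sesquilinear form with $\mathrm{Dom}[\mathfrak v]\supset\mathrm{Dom}[\mathfrak a]$ that is off-diagonal and $\mathfrak a$-bounded: $$\mathfrak v[Jx,y]=-\mathfrak v[x,Jy]\quad (x,y\in\mathrm{Dom}[\mathfrak a]),\qquad \sup_{0\ne x\in\mathrm{Dom}[\mathfrak a]}\frac{|\mathfrak v[x]|}{\mathfrak a_J[x]}<\infty .$$ On $\mathrm{Dom}[\mathfrak b]=\mathrm{Dom}[\mathfrak a]$ let $\mathfrak b[x,y]=\mathfrak a[x,y]+\mathfrak v[x,y]$, which is a symmetric form. Then: (i) there is a unique self-adjoint operator $B$ in $\mathfrak H$ such that $\mathrm{Dom}(B)\subset\mathrm{Dom}[\mathfrak b]$ and $\mathfrak b[x,y]=\langle x,By\rangle$ for all $x\in\mathrm{Dom}[\mathfrak b]$, $y\in\mathrm{Dom}(B)$; (ii) $B$ is boundedly invertible (that is, $B:\mathrm{Dom}(B)\to\mathfrak H$ is bijective with bounded inverse), and the open interval $(-m_-,m_+)$, which contains $0$,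 belongs to the resolvent set of $B$. -/

import Mathlib

/-- A sesquilinear form on a (not necessarily closed, not necessarily dense) linear subspace
`domain` of a complex Hilbert space; conjugate-linear in the first, linear in the second variable,
as is `inner ℂ`. -/
structure SesqForm (H : Type*) [NormedAddCommGroup H] [InnerProductSpace ℂ H] where
  domain : Submodule ℂ H
  form : domain →ₗ⋆[ℂ] domain →ₗ[ℂ] ℂ

namespace SesqForm

variable {H : Type*} [NormedAddCommGroup H] [InnerProductSpace ℂ H]

/-- The value `s[x, y]`. -/
instance : CoeFun (SesqForm H) (fun s => s.domain → s.domain → ℂ) where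
  coe s := fun x y => s.form x y

/-- `s[x, y]` is the complex conjugate of `s[y, x]`. -/
def IsSymmetric (s : SesqForm H) : Prop :=
  ∀ x y : s.domain, s x y = star (s y x)

/-- The quadratic form `s[x] = s[x, x]`, as a real number (for a symmetric form `s[x, x]` is
real, so that taking the real part loses nothing). -/
def quad (s : SesqForm H) (x : s.domain) : ℝ := (s x x).re

/-- `s` is symmetric and has a positive lower bound. -/
def IsPositiveDefinite (s : SesqForm H) : Prop :=
  s.IsSymmetric ∧ ∃ c : ℝ, 0 < c ∧ ∀ x : s.domain, c * ‖(x : H)‖ ^ 2 ≤ s.quad x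

/-- Closedness: if `u n ∈ Dom[s]`, `u n → x` in `H` and `s[u n - u m] → 0` as `n, m → ∞`,
then `x ∈ Dom[s]` and `s[u n - x] → 0`. -/
def IsClosed (s : SesqForm H) : Prop :=
  ∀ (u : ℕ → s.domain) (x : H),
    Filter.Tendsto (fun n => (u n : H)) Filter.atTop (nhds x) →
    Filter.Tendsto (fun p : ℕ × ℕ => s (u p.1 - u p.2) (u p.1 - u p.2))
      (Filter.atTop ×ˢ Filter.atTop) (nhds 0) →
    ∃ y : s.domain, (y : H) = x ∧
      Filter.Tendsto (fun n => s (u n - y) (u n - y)) Filter.atTop (nhds 0)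

/-- The restriction of a form to a smaller domain. -/
def restrict (s : SesqForm H) (D : Submodule ℂ H) (h : D ≤ s.domain) : SesqForm H where
  domain := D
  form := (s.form.comp (Submodule.inclusion h)).compl₂ (Submodule.inclusion h)

/-- The sum `a + v`, on `Dom[a]`, of a form `a` and a form `v` with `Dom[a] ⊆ Dom[v]`. -/
def perturb (a v : SesqForm H) (h : a.domain ≤ v.domain) : SesqForm H where
  domain := a.domain
  form := a.form + (v.form.comp (Submodule.inclusion h)).compl₂ (Submodule.inclusion h)

/-- A bounded operator `J` with `J D = D`, as a map `D → D`. -/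
def onDomain (J : H →L[ℂ] H) (D : Submodule ℂ H) (hJ : D.map (J : H →ₗ[ℂ] H) = D) :
    D →ₗ[ℂ] D :=
  (J : H →ₗ[ℂ] H).restrict fun _ hx => hJ.le (Submodule.mem_map_of_mem hx)

/-- The form `a_J[x, y] = a[x, J y]` on `Dom[a]`. -/
def twist (a : SesqForm H) (J : H →L[ℂ] H) (hJ : a.domain.map (J : H →ₗ[ℂ] H) = a.domain) :
    SesqForm H where
  domain := a.domain
  form := a.form.compl₂ (onDomain J a.domain hJ)

/-- `a[J x, y] = a[x, J y]` on `Dom[a]`. -/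
def IsDiagonal (a : SesqForm H) (J : H →L[ℂ] H)
    (hJ : a.domain.map (J : H →ₗ[ℂ] H) = a.domain) : Prop :=
  ∀ x y : a.domain, a (onDomain J a.domain hJ x) y = a x (onDomain J a.domain hJ y)

/-- `v[J x, y] = - v[x, J y]` on `Dom[v]`. -/
def IsOffDiagonal (v : SesqForm H) (J : H →L[ℂ] H)
    (hJ : v.domain.map (J : H →ₗ[ℂ] H) = v.domain) : Prop :=
  ∀ x y : v.domain, v (onDomain J v.domain hJ x) y = - v x (onDomain J v.domain hJ y)

/-- The greatest lower bound of `s` on `K ∩ Dom[s]`: the infimum of `s[x] / ‖x‖²` over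
`0 ≠ x ∈ K ∩ Dom[s]`, an extended real number (`⊤` if there is no such `x`). -/
noncomputable def lowerBound (s : SesqForm H) (K : Submodule ℂ H) : EReal :=
  ⨅ (x : s.domain) (_ : (x : H) ∈ K ∧ (x : H) ≠ 0), ((s.quad x / ‖(x : H)‖ ^ 2 : ℝ) : EReal)

/-- `Dom(B) ⊆ Dom[s]` and `s[x, y] = ⟨x, B y⟩` for `x ∈ Dom[s]`, `y ∈ Dom(B)`. -/
def IsRepresentedBy (s : SesqForm H) (B : H →ₗ.[ℂ] H) : Prop :=
  ∃ h : B.domain ≤ s.domain, ∀ (x : s.domain) (y : B.domain),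
    s x (Submodule.inclusion h y) = inner ℂ (x : H) (B y)

end SesqForm

/-- `B : Dom(B) → H` is bijective and its inverse is a bounded operator on `H`. -/
def LinearPMap.IsBoundedlyInvertible {H : Type*} [NormedAddCommGroup H] [InnerProductSpace ℂ H]
    (B : H →ₗ.[ℂ] H) : Prop :=
  ∃ R : H →L[ℂ] H, (∀ x : H, ∃ h : R x ∈ B.domain, B ⟨R x, h⟩ = x) ∧
    ∀ y : B.domain, R (B y) = y

/-- The set of all `z` such that `B - z I : Dom(B) → H` is bijective with bounded inverse. -/
def LinearPMap.resolventSet {H : Type*} [NormedAddCommGroup H] [InnerProductSpace ℂ H]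
    (B : H →ₗ.[ℂ] H) : Set ℂ :=
  {z | ∃ R : H →L[ℂ] H, (∀ x : H, ∃ h : R x ∈ B.domain, B ⟨R x, h⟩ - z • R x = x) ∧
    ∀ y : B.domain, R (B y - z • (y : H)) = y}

namespace SesqForm

variable {H : Type*} [NormedAddCommGroup H] [InnerProductSpace ℂ H]

/-! ### The Hilbert space of a closed positive definite form -/

/-- The domain of a form, without the norm inherited from the ambient space. -/
def FormDomain (s : SesqForm H) : Type _ := s.domain

instance (s : SesqForm H) : AddCommGroup s.FormDomain :=
  inferInstanceAs (AddCommGroup s.domain)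

instance (s : SesqForm H) : Module ℂ s.FormDomain :=
  inferInstanceAs (Module ℂ s.domain)

/-- The identification of `FormDomain s` with `Dom[s]`. -/
def formDomainEquiv (s : SesqForm H) : s.FormDomain ≃ₗ[ℂ] s.domain :=
  LinearEquiv.refl ℂ s.domain

theorem IsPositiveDefinite.quad_nonneg {s : SesqForm H} (hs : s.IsPositiveDefinite)
    (x : s.domain) : 0 ≤ s.quad x := by
  obtain ⟨-, c, hc, h⟩ := hs
  exact le_trans (by positivity) (h x)

/-- A positive definite form is an inner product on its domain. -/
@[reducible]
noncomputable def IsPositiveDefinite.core {s : SesqForm H} (hs : s.IsPositiveDefinite) :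
    InnerProductSpace.Core ℂ s.FormDomain where
  inner x y := s (s.formDomainEquiv x) (s.formDomainEquiv y)
  conj_inner_symm x y := (hs.1 _ _).symm
  re_inner_nonneg x := hs.quad_nonneg _
  add_left x y z := by simp
  smul_left x y r := by simp
  definite x hx := by
    obtain ⟨-, c, hc, h⟩ := hs
    have h1 := h (s.formDomainEquiv x)
    rw [quad, hx, Complex.zero_re] at h1
    have h2 : ‖(s.formDomainEquiv x : H)‖ ^ 2 ≤ 0 := by
      by_contra! h3
      have := mul_pos hc h3
      linarith
    have h3 : ‖(s.formDomainEquiv x : H)‖ = 0 := by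
      have := sq_nonneg ‖(s.formDomainEquiv x : H)‖
      exact pow_eq_zero_iff two_ne_zero |>.1 (le_antisymm h2 this)
    rw [norm_eq_zero, ZeroMemClass.coe_eq_zero] at h3
    exact (LinearEquiv.map_eq_zero_iff _).1 h3

theorem exists_hilbertSpace.{u} {H : Type u} [NormedAddCommGroup H] [InnerProductSpace ℂ H]
    [CompleteSpace H] (s : SesqForm H) (hs : s.IsPositiveDefinite)
    (hcl : s.IsClosed) :
    ∃ (V : Type u) (_ : NormedAddCommGroup V) (_ : InnerProductSpace ℂ V) (_ : CompleteSpace V)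
      (e : V ≃ₗ[ℂ] s.domain), ∀ x y : V, inner ℂ x y = s (e x) (e y) := by
  let _ : NormedAddCommGroup s.FormDomain := hs.core.toNormedAddCommGroup
  let _ : InnerProductSpace ℂ s.FormDomain := InnerProductSpace.ofCore hs.core.toCore
  let e := s.formDomainEquiv
  have hin : ∀ x y : s.FormDomain, inner ℂ x y = s (e x) (e y) := fun _ _ => rfl
  have hsq : ∀ x : s.FormDomain, s (e x) (e x) = ((‖x‖ ^ 2 : ℝ) : ℂ) := fun x => by
    rw [← hin, inner_self_eq_norm_sq_to_K]; norm_cast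
  refine ⟨s.FormDomain, inferInstance, inferInstance, ?_, e, hin⟩
  refine Metric.complete_of_cauchySeq_tendsto fun u hu => ?_
  obtain ⟨c, hc, h⟩ := hs.2
  have hquad : ∀ x : s.FormDomain, c * ‖(e x : H)‖ ^ 2 ≤ ‖x‖ ^ 2 := fun x => by
    have := h (e x)
    rwa [quad, hsq, Complex.ofReal_re] at this
  have hbound : ∀ x : s.FormDomain, ‖(e x : H)‖ ≤ (√c)⁻¹ * ‖x‖ := fun x => by
    have h1 := Real.sqrt_le_sqrt (hquad x)
    rw [Real.sqrt_mul hc.le, Real.sqrt_sq (norm_nonneg _), Real.sqrt_sq (norm_nonneg _)] at h1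
    rwa [inv_mul_eq_div, le_div_iff₀' (Real.sqrt_pos.2 hc)]
  let ι : s.FormDomain →L[ℂ] H :=
    (s.domain.subtype ∘ₗ (e : s.FormDomain →ₗ[ℂ] s.domain)).mkContinuous _ hbound
  obtain ⟨x, hx⟩ := cauchySeq_tendsto_of_complete (ι.uniformContinuous.comp_cauchySeq hu)
  obtain ⟨y, -, hy⟩ := hcl (fun n => e (u n)) x hx (by
    have h1 : Filter.Tendsto (fun p : ℕ × ℕ => dist (u p.1) (u p.2))
        (Filter.atTop ×ˢ Filter.atTop) (nhds 0) := by
      rw [Filter.prod_atTop_atTop_eq]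
      exact cauchySeq_iff_tendsto_dist_atTop_0.1 hu
    have h2 := (Complex.continuous_ofReal.tendsto _).comp (h1.pow 2)
    simp only [ne_eq, OfNat.ofNat_ne_zero, not_false_eq_true, zero_pow, Complex.ofReal_zero] at h2
    refine h2.congr fun p => ?_
    rw [← map_sub, hsq, ← dist_eq_norm]
    rfl)
  refine ⟨e.symm y, tendsto_iff_norm_sub_tendsto_zero.2 ?_⟩
  have h1 := ((Complex.continuous_re.tendsto _).comp hy).sqrt
  rw [Complex.zero_re, Real.sqrt_zero] at h1
  refine h1.congr fun n => ?_
  have h2 : e (u n) - y = e (u n - e.symm y) := by simp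
  rw [Function.comp_apply, h2, hsq, Complex.ofReal_re, Real.sqrt_sq (norm_nonneg _)]

end SesqForm

/-! ### Bounded sesquilinear forms on a Hilbert space -/

section LaxMilgram

variable {V H : Type*} [NormedAddCommGroup V] [InnerProductSpace ℂ V]
  [NormedAddCommGroup H] [InnerProductSpace ℂ H]

/-- A symmetric sesquilinear form is bounded as soon as its quadratic form is. -/
theorem norm_sesqForm_le_of_norm_diag_le (β : V →ₗ⋆[ℂ] V →ₗ[ℂ] ℂ)
    (hβ : ∀ x y, β x y = star (β y x)) {C : ℝ} (hC : ∀ x, |(β x x).re| ≤ C * ‖x‖ ^ 2) (x y : V) :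
    ‖β x y‖ ≤ C * ‖x‖ * ‖y‖ := by
  have hre : ∀ x y, (β y x).re = (β x y).re := fun x y => by
    rw [hβ y x]; exact Complex.conj_re _
  have hpol : ∀ x y, (β x y).re ≤ C / 2 * (‖x‖ ^ 2 + ‖y‖ ^ 2) := fun x y => by
    have h1 := (abs_le.1 (hC (x + y))).2
    have h2 := (abs_le.1 (hC (x - y))).1
    have h3 := parallelogram_law_with_norm ℂ x y
    have h4 : C * ‖x + y‖ ^ 2 + C * ‖x - y‖ ^ 2 = 2 * C * (‖x‖ ^ 2 + ‖y‖ ^ 2) := by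
      linear_combination C * h3
    simp only [map_add, map_sub, LinearMap.add_apply, LinearMap.sub_apply, Complex.add_re,
      Complex.sub_re] at h1 h2
    have := hre x y
    linarith
  have hnorm : ∀ x y, ‖β x y‖ ≤ C / 2 * (‖x‖ ^ 2 + ‖y‖ ^ 2) := fun x y => by
    obtain ⟨w, hw, hwz⟩ : ∃ w : ℂ, ‖w‖ = 1 ∧ w * β x y = (‖β x y‖ : ℂ) := by
      by_cases h0 : β x y = 0
      · exact ⟨1, by simp, by simp [h0]⟩
      · have h0' : (‖β x y‖ : ℂ) ≠ 0 := by simpa using h0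
        refine ⟨star (β x y) / (‖β x y‖ : ℂ), ?_, ?_⟩
        · simp [h0]
        · rw [div_mul_eq_mul_div, div_eq_iff h0', mul_comm]
          exact (Complex.mul_conj' _).trans (sq _)
    have h1 := hpol x (w • y)
    rwa [map_smul, smul_eq_mul, hwz, Complex.ofReal_re, norm_smul, hw, one_mul] at h1
  rcases eq_or_ne x 0 with rfl | hx
  · simp
  rcases eq_or_ne y 0 with rfl | hy
  · simp
  have hx' := norm_pos_iff.2 hx
  have hy' := norm_pos_iff.2 hy
  have h1 := hnorm ((‖y‖ : ℂ) • x) ((‖x‖ : ℂ) • y)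
  simp only [map_smulₛₗ, RingHom.id_apply, LinearMap.smul_apply, smul_eq_mul, norm_mul, norm_smul,
    Complex.conj_ofReal, Complex.norm_real, norm_norm] at h1
  have h2 : (‖x‖ * ‖y‖) * ‖β x y‖ ≤ (‖x‖ * ‖y‖) * (C * ‖x‖ * ‖y‖) := by linarith
  exact le_of_mul_le_mul_left h2 (by positivity)

/-- The Lax-Milgram theorem for a form that is coercive after composition with an involution. -/
theorem exists_solutionOperator [CompleteSpace V] [CompleteSpace H] (ι : V →L[ℂ] H)
    (β : V →ₗ⋆[ℂ] V →ₗ[ℂ] ℂ) {C : ℝ} (hC : ∀ x y, ‖β x y‖ ≤ C * ‖x‖ * ‖y‖)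
    (j : V →L[ℂ] V) (hj : ∀ x, j (j x) = x) {δ : ℝ} (hδ : 0 < δ)
    (hcoer : ∀ y, δ * ‖y‖ ^ 2 ≤ (β (j y) y).re) :
    ∃ R : H →L[ℂ] V, ∀ y f, (∀ x, β x y = inner ℂ (ι x) f) ↔ y = R f := by
  let T : V →L[ℂ] V := InnerProductSpace.continuousLinearMapOfBilin (β.mkContinuous₂ C hC)
  have hT : ∀ x y, inner ℂ (T x) y = β x y := fun x y =>
    InnerProductSpace.continuousLinearMapOfBilin_apply _ _ _
  have hTj : IsUnit (T ∘L j) := by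
    refine ContinuousLinearMap.isUnit_of_forall_le_norm_inner_map _ (c := ⟨δ, hδ.le⟩) hδ
      fun y => ?_
    rw [ContinuousLinearMap.comp_apply, hT, mul_comm]
    exact (hcoer y).trans (Complex.re_le_norm _)
  have hjj : j * j = 1 := by ext x; exact hj x
  have hTu : IsUnit T := by
    have : IsUnit j := ⟨⟨j, j, hjj, hjj⟩, rfl⟩
    have h2 : T = (T ∘L j) * j := by
      ext x; simp [hj]
    rw [h2]
    exact hTj.mul this
  obtain ⟨S, hS⟩ := hTu.star
  have hS' : ∀ x y, inner ℂ x (S.val y) = β x y := fun x y => by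
    rw [hS, ContinuousLinearMap.star_eq_adjoint, ContinuousLinearMap.adjoint_inner_right, hT]
  have hi1 : ∀ y, S.val (S.inv y) = y := fun y => DFunLike.congr_fun S.val_inv y
  have hi2 : ∀ y, S.inv (S.val y) = y := fun y => DFunLike.congr_fun S.inv_val y
  refine ⟨S.inv ∘L ContinuousLinearMap.adjoint ι, fun y f => ⟨fun h => ?_, ?_⟩⟩
  · have h1 : S.val y = ContinuousLinearMap.adjoint ι f := by
      refine ext_inner_left ℂ fun x => ?_
      rw [hS', h, ContinuousLinearMap.adjoint_inner_right]
    rw [ContinuousLinearMap.comp_apply, ← h1, hi2]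
  · rintro rfl x
    rw [← hS', ContinuousLinearMap.comp_apply, hi1, ContinuousLinearMap.adjoint_inner_right]

end LaxMilgram

/-! ### Inverses of bounded symmetric operators -/

section Inverse

variable {H : Type*} [NormedAddCommGroup H] [InnerProductSpace ℂ H] [CompleteSpace H]

/-- The inverse of an injective bounded symmetric operator is self-adjoint. -/
theorem exists_isSelfAdjoint_inverse (R : H →L[ℂ] H)
    (hsymm : ∀ f g, inner ℂ (R f) g = inner ℂ f (R g)) (hinj : ∀ f, R f = 0 → f = 0) :
    ∃ B : H →ₗ.[ℂ] H, IsSelfAdjoint B ∧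
      ∀ y g, (∃ h : y ∈ B.domain, B ⟨y, h⟩ = g) ↔ y = R g := by
  have hinj' : Function.Injective (R : H →ₗ[ℂ] H) :=
    (injective_iff_map_eq_zero (R : H →ₗ[ℂ] H)).2 hinj
  let E := LinearEquiv.ofInjective (R : H →ₗ[ℂ] H) hinj'
  let B : H →ₗ.[ℂ] H := ⟨LinearMap.range (R : H →ₗ[ℂ] H), E.symm.toLinearMap⟩
  have hBR : ∀ (f : H) (h : R f ∈ B.domain), B ⟨R f, h⟩ = f := fun f h => E.symm_apply_apply f
  have hmem : ∀ f, R f ∈ B.domain := fun f => ⟨f, rfl⟩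
  have hB : ∀ y g, (∃ h : y ∈ B.domain, B ⟨y, h⟩ = g) ↔ y = R g := by
    refine fun y g => ⟨?_, ?_⟩
    · rintro ⟨⟨f, rfl⟩, h⟩
      have := hBR f (hmem f)
      exact congrArg R (this.symm.trans h)
    · rintro rfl
      exact ⟨hmem g, hBR g _⟩
  have hdense : Dense (B.domain : Set H) := by
    rw [Submodule.dense_iff_topologicalClosure_eq_top, Submodule.topologicalClosure_eq_top_iff,
      Submodule.eq_bot_iff]
    intro x hx
    refine hinj x (ext_inner_left ℂ fun f => ?_)
    rw [← hsymm, inner_zero_right]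
    exact hx _ (hmem f)
  have hformal : B.IsFormalAdjoint B := by
    rintro ⟨_, f, rfl⟩ ⟨_, g, rfl⟩
    have h1 := hBR f (hmem f)
    have h2 := hBR g (hmem g)
    change inner ℂ (B ⟨R f, hmem f⟩) (R g) = inner ℂ (R f) (B ⟨R g, hmem g⟩)
    rw [h1, h2, hsymm]
  refine ⟨B, ?_, hB⟩
  rw [LinearPMap.isSelfAdjoint_def]
  refine le_antisymm ?_ (hformal.le_adjoint hdense)
  have key : ∀ y : B.adjoint.domain, (y : H) = R (B.adjoint y) := fun y => by
    refine ext_inner_right ℂ fun f => ?_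
    have h1 := LinearPMap.adjoint_isFormalAdjoint hdense y ⟨R f, hmem f⟩
    rw [hBR] at h1
    rw [← h1, hsymm]
  refine ⟨fun y hy => ((hB y _).2 (key ⟨y, hy⟩)).1, ?_⟩
  rintro y ⟨z, hz⟩ hyz
  obtain ⟨h1, h2⟩ := (hB _ _).2 (key y)
  rw [← h2]
  congr 1
  exact Subtype.ext hyz

theorem LinearPMap.eq_of_le_of_isSelfAdjoint {A B : H →ₗ.[ℂ] H} (hA : IsSelfAdjoint A)
    (hB : IsSelfAdjoint B) (h : A ≤ B) : A = B := by
  refine le_antisymm h ?_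
  have h1 : A.IsFormalAdjoint B := fun x y => by
    have h2 := LinearPMap.adjoint_isFormalAdjoint hB.dense_domain
    rw [LinearPMap.isSelfAdjoint_def.1 hB] at h2
    rw [h.2 (y := ⟨x, h.1 x.2⟩) rfl]
    exact h2 ⟨x, h.1 x.2⟩ y
  have := h1.le_adjoint hA.dense_domain
  rwa [LinearPMap.isSelfAdjoint_def.1 hA] at this

end Inverse

namespace SesqForm

section Solvability

variable {H : Type*} [NormedAddCommGroup H] [InnerProductSpace ℂ H] [CompleteSpace H]

/-- Solvability of `β[x, y] = ⟨x, f⟩` for a symmetric form `β` that is bounded, and coercive up to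
an isometric involution `j`, with respect to a closed positive definite form `s`. -/
theorem exists_resolvent (s : SesqForm H) (hs : s.IsPositiveDefinite) (hcl : s.IsClosed)
    (j : s.domain →ₗ[ℂ] s.domain) (hj : ∀ x, j (j x) = x) (hjs : ∀ x, s.quad (j x) = s.quad x)
    (β : s.domain →ₗ⋆[ℂ] s.domain →ₗ[ℂ] ℂ) (hβ : ∀ x y, β x y = star (β y x))
    {C : ℝ} (hC : ∀ x, |(β x x).re| ≤ C * s.quad x) {δ : ℝ} (hδ : 0 < δ)
    (hcoer : ∀ y, δ * s.quad y ≤ (β (j y) y).re) :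
    ∃ R : H →L[ℂ] H, (∀ f, R f ∈ s.domain) ∧
      ∀ (y : s.domain) f, (∀ x : s.domain, β x y = inner ℂ (x : H) f) ↔ (y : H) = R f := by
  obtain ⟨V, _, _, _, e, he⟩ := s.exists_hilbertSpace hs hcl
  obtain ⟨-, c, hc, h⟩ := hs
  have hquad : ∀ x, s.quad (e x) = ‖x‖ ^ 2 := fun x => by
    rw [quad, ← he, inner_self_eq_norm_sq_to_K]; norm_cast
  have hbound : ∀ x, ‖(e x : H)‖ ≤ (√c)⁻¹ * ‖x‖ := fun x => by
    have h1 := h (e x)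
    rw [hquad] at h1
    have h1 := Real.sqrt_le_sqrt h1
    rw [Real.sqrt_mul hc.le, Real.sqrt_sq (norm_nonneg _), Real.sqrt_sq (norm_nonneg _)] at h1
    rwa [inv_mul_eq_div, le_div_iff₀' (Real.sqrt_pos.2 hc)]
  let ι : V →L[ℂ] H := (s.domain.subtype ∘ₗ (e : V →ₗ[ℂ] s.domain)).mkContinuous _ hbound
  have hι : ∀ x, ι x = (e x : H) := fun _ => rfl
  let j' : V →L[ℂ] V := ((e.symm : s.domain →ₗ[ℂ] V) ∘ₗ j ∘ₗ (e : V →ₗ[ℂ] s.domain)).mkContinuous 1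
    (fun x => by
      refine le_of_eq ?_
      rw [one_mul, ← sq_eq_sq₀ (norm_nonneg _) (norm_nonneg _), ← hquad, ← hquad]
      simp [hjs])
  have hj' : ∀ x, e (j' x) = j (e x) := fun x => e.apply_symm_apply _
  let β' : V →ₗ⋆[ℂ] V →ₗ[ℂ] ℂ := (β.comp (e : V →ₗ[ℂ] s.domain)).compl₂ (e : V →ₗ[ℂ] s.domain)
  have hβ' : ∀ x y, β' x y = β (e x) (e y) := fun _ _ => rfl
  obtain ⟨R, hR⟩ := exists_solutionOperator ι β'
    (norm_sesqForm_le_of_norm_diag_le β' (fun x y => hβ _ _) (C := C)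
      fun x => by rw [← hquad]; exact hC _) j' (fun x => by
        apply e.injective; rw [hj', hj', hj]) hδ (fun y => by
        rw [hβ', hj', ← hquad]; exact hcoer _)
  refine ⟨ι ∘L R, fun f => (e (R f)).2, fun y f => ?_⟩
  have h1 := hR (e.symm y) f
  rw [ContinuousLinearMap.comp_apply, hι, Subtype.coe_inj, ← LinearEquiv.symm_apply_eq, ← h1]
  refine ⟨fun h x => ?_, fun h x => ?_⟩
  · rw [hβ', hι, e.apply_symm_apply, h]
  · have := h (e.symm x)
    rwa [hβ', hι, e.apply_symm_apply, e.apply_symm_apply] at this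

end Solvability

variable {H : Type*} [NormedAddCommGroup H] [InnerProductSpace ℂ H]

/-! ### Lower bounds -/

theorem IsPositiveDefinite.lowerBound_pos {s : SesqForm H} (hs : s.IsPositiveDefinite)
    (K : Submodule ℂ H) : 0 < s.lowerBound K := by
  obtain ⟨-, c, hc, h⟩ := hs
  refine lt_of_lt_of_le (EReal.coe_pos.2 hc) (le_iInf₂ fun x hx => ?_)
  rw [EReal.coe_le_coe_iff, le_div_iff₀ (by have := norm_pos_iff.2 hx.2; positivity)]
  exact h x

/-- Below the greatest lower bound of `s` on `K`, the form `s - μ` still dominates a multiple of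
`s` on `K`. -/
theorem IsPositiveDefinite.exists_gap {s : SesqForm H} (hs : s.IsPositiveDefinite)
    {K : Submodule ℂ H} {μ : ℝ} (hμ : (μ : EReal) < s.lowerBound K) :
    ∃ δ : ℝ, 0 < δ ∧ ∀ x : s.domain, (x : H) ∈ K →
      μ * ‖(x : H)‖ ^ 2 ≤ (1 - δ) * s.quad x := by
  have h0 : ((max μ 0 : ℝ) : EReal) < s.lowerBound K := by
    rcases max_choice μ 0 with h | h <;> rw [h]
    · exact hμ
    · exact hs.lowerBound_pos K
  obtain ⟨m, hm1, hm2⟩ := EReal.lt_iff_exists_real_btwn.1 h0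
  rw [EReal.coe_lt_coe_iff] at hm1
  have hm : 0 < m := (le_max_right _ _).trans_lt hm1
  refine ⟨1 - max μ 0 / m, sub_pos.2 ((div_lt_one hm).2 hm1), fun x hx => ?_⟩
  rw [sub_sub_cancel]
  by_cases hx0 : (x : H) = 0
  · have := hs.quad_nonneg x
    rw [hx0, norm_zero]
    have : 0 ≤ max μ 0 / m * s.quad x := by positivity
    simpa
  have h1 : (m : EReal) ≤ ((s.quad x / ‖(x : H)‖ ^ 2 : ℝ) : EReal) :=
    hm2.le.trans (iInf₂_le x ⟨hx, hx0⟩)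
  rw [EReal.coe_le_coe_iff, le_div_iff₀ (by have := norm_pos_iff.2 hx0; positivity)] at h1
  calc μ * ‖(x : H)‖ ^ 2 ≤ max μ 0 * ‖(x : H)‖ ^ 2 := by gcongr; exact le_max_left _ _
    _ = max μ 0 / m * (m * ‖(x : H)‖ ^ 2) := by field_simp
    _ ≤ max μ 0 / m * s.quad x := by gcongr

/-! ### Off-diagonal perturbations -/

theorem onDomain_onDomain {J : H →L[ℂ] H} (hJ_inv : J ∘L J = ContinuousLinearMap.id ℂ H)
    {D : Submodule ℂ H} (hJ : D.map (J : H →ₗ[ℂ] H) = D) (x : D) :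
    onDomain J D hJ (onDomain J D hJ x) = x :=
  Subtype.ext (congrArg (fun A : H →L[ℂ] H => A x) hJ_inv)

theorem quad_zero (s : SesqForm H) : s.quad 0 = 0 := by simp [quad]

theorem IsSymmetric.re_comm {s : SesqForm H} (hs : s.IsSymmetric) (x y : s.domain) :
    (s y x).re = (s x y).re := by
  rw [hs y x]; exact Complex.conj_re _

theorem IsSymmetric.quad_add {s : SesqForm H} (hs : s.IsSymmetric) (x y : s.domain) :
    s.quad (x + y) = s.quad x + 2 * (s x y).re + s.quad y := by
  have := hs.re_comm x y
  simp only [quad, map_add, LinearMap.add_apply, Complex.add_re]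
  linarith

theorem IsSymmetric.quad_sub {s : SesqForm H} (hs : s.IsSymmetric) (x y : s.domain) :
    s.quad (x - y) = s.quad x - 2 * (s x y).re + s.quad y := by
  have := hs.re_comm x y
  simp only [quad, map_sub, LinearMap.sub_apply, Complex.sub_re]
  linarith

theorem IsSymmetric.perturb {a v : SesqForm H} (ha : a.IsSymmetric) (hv : v.IsSymmetric)
    (hav : a.domain ≤ v.domain) : (a.perturb v hav).IsSymmetric := fun x y =>
  (congrArg₂ (· + ·) (ha x y) (hv _ _)).trans (star_add _ _).symm

/-- The inner product of `H`, as a form on the subspace `D`. -/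
noncomputable def innerForm (D : Submodule ℂ H) : D →ₗ⋆[ℂ] D →ₗ[ℂ] ℂ :=
  ((innerₛₗ ℂ : H →ₗ⋆[ℂ] H →ₗ[ℂ] ℂ).comp D.subtype).compl₂ D.subtype

theorem innerForm_apply (D : Submodule ℂ H) (x y : D) :
    innerForm D x y = inner ℂ (x : H) (y : H) := rfl

theorem exists_resolvent_perturb [CompleteSpace H] {a : SesqForm H} (ha_symm : a.IsSymmetric)
    {J : H →L[ℂ] H} (hJ_sa : IsSelfAdjoint J) (hJ_inv : J ∘L J = ContinuousLinearMap.id ℂ H)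
    (hJ : a.domain.map (J : H →ₗ[ℂ] H) = a.domain) (ha_diag : a.IsDiagonal J hJ)
    (haJ_pos : (a.twist J hJ).IsPositiveDefinite) (haJ_closed : (a.twist J hJ).IsClosed)
    {v : SesqForm H} (hv_symm : v.IsSymmetric) (hav : a.domain ≤ v.domain)
    (hv_off : (v.restrict a.domain hav).IsOffDiagonal J hJ)
    (hv_bdd : BddAbove {r : ℝ | ∃ x : a.domain, x ≠ 0 ∧
      r = |(v.restrict a.domain hav).quad x| / (a.twist J hJ).quad x})
    {μ : ℝ}
    (hμp : (μ : EReal) < (a.twist J hJ).lowerBound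
      (LinearMap.range ((ContinuousLinearMap.id ℂ H + J : H →L[ℂ] H) : H →ₗ[ℂ] H)))
    (hμm : ((-μ : ℝ) : EReal) < (a.twist J hJ).lowerBound
      (LinearMap.range ((ContinuousLinearMap.id ℂ H - J : H →L[ℂ] H) : H →ₗ[ℂ] H))) :
    ∃ R : H →L[ℂ] H, (∀ f, R f ∈ a.domain) ∧ ∀ (y : a.domain) f,
      (∀ x : a.domain, (a.perturb v hav) x y - μ * inner ℂ (x : H) (y : H) = inner ℂ (x : H) f) ↔
        (y : H) = R f := by
  set s := a.twist J hJ
  let j : a.domain →ₗ[ℂ] a.domain := onDomain J a.domain hJ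
  let w : SesqForm H := v.restrict a.domain hav
  have hjj : ∀ x, j (j x) = x := onDomain_onDomain hJ_inv hJ
  have hsa : ∀ x y : a.domain, s x y = a x (j y) := fun _ _ => rfl
  have has : ∀ x y : a.domain, a x y = s x (j y) := fun x y => by rw [hsa, hjj]
  have hquadj : ∀ x : a.domain, s.quad (j x) = s.quad x := fun x => by
    have h1 : s (j x) (j x) = s x x := by
      rw [hsa, hsa, hjj]; exact ha_diag x x
    exact congrArg Complex.re h1
  have hq0 : ∀ x : a.domain, 0 ≤ s.quad x := haJ_pos.quad_nonneg
  have hsum : ∀ x : a.domain, s.quad (x + j x) = 2 * s.quad x + 2 * (a x x).re := fun x => by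
    have h1 := haJ_pos.1.quad_add x (j x)
    have h2 := hquadj x
    rw [has]
    exact h1.trans (by linarith)
  have hdiff : ∀ x : a.domain, s.quad (x - j x) = 2 * s.quad x - 2 * (a x x).re := fun x => by
    have h1 := haJ_pos.1.quad_sub x (j x)
    have h2 := hquadj x
    rw [has]
    exact h1.trans (by linarith)
  have hJnorm : ∀ x : H, ‖J x‖ ^ 2 = ‖x‖ ^ 2 := fun x => by
    have h1 : inner ℂ (J x) (J x) = inner ℂ x x := by
      rw [← ContinuousLinearMap.adjoint_inner_right, ← ContinuousLinearMap.star_eq_adjoint,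
        hJ_sa.star_eq]
      exact congrArg (fun A : H →L[ℂ] H => inner ℂ x (A x)) hJ_inv
    rw [← inner_self_eq_norm_sq (𝕜 := ℂ), h1, inner_self_eq_norm_sq]
  obtain ⟨K, hK⟩ := hv_bdd
  have hw_bdd : ∀ x : a.domain, |w.quad x| ≤ K * s.quad x := fun x => by
    rcases eq_or_ne x 0 with rfl | hx
    · have h1 : w.quad (0 : a.domain) = 0 := w.quad_zero
      have h2 : s.quad (0 : a.domain) = 0 := s.quad_zero
      rw [h1, h2, abs_zero, mul_zero]
    · obtain ⟨c, hc, h⟩ := haJ_pos.2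
      have h1 : 0 < s.quad x := by
        have : 0 < ‖(x : H)‖ := norm_pos_iff.2 (by simpa using hx)
        exact lt_of_lt_of_le (by positivity) (h x)
      exact (div_le_iff₀ h1).1 (hK ⟨x, hx, rfl⟩)
  have hwj : ∀ y : a.domain, (w (j y) y).re = 0 := fun y => by
    have h1 : w (j y) y = -w y (j y) := hv_off y y
    have h2 : w (j y) y = star (w y (j y)) := hv_symm _ _
    have h3 := congrArg Complex.re h1
    have h4 := (congrArg Complex.re h2).trans (Complex.conj_re _)
    rw [Complex.neg_re] at h3
    linarith
  let b : a.domain →ₗ⋆[ℂ] a.domain →ₗ[ℂ] ℂ := (a.perturb v hav).form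
  let β : a.domain →ₗ⋆[ℂ] a.domain →ₗ[ℂ] ℂ := b - (μ : ℂ) • innerForm a.domain
  have hβ : ∀ x y : a.domain, β x y = a x y + w x y - μ * inner ℂ (x : H) (y : H) :=
    fun _ _ => rfl
  obtain ⟨δ₁, hδ₁, h₁⟩ := haJ_pos.exists_gap hμp
  obtain ⟨δ₂, hδ₂, h₂⟩ := haJ_pos.exists_gap hμm
  have hreal : ∀ z : ℂ, ((μ : ℂ) * z).re = μ * z.re := fun z => Complex.re_ofReal_mul _ _
  obtain ⟨c, hc, h⟩ := haJ_pos.2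
  have hβ_symm : ∀ x y : a.domain, β x y = star (β y x) := fun x y => by
    have h1 : a x y = star (a y x) := ha_symm x y
    have h2 : w x y = star (w y x) := hv_symm _ _
    have h3 : inner ℂ (x : H) (y : H) = star (inner ℂ (y : H) (x : H)) :=
      (inner_conj_symm _ _).symm
    have h4 : star (μ : ℂ) = μ := Complex.conj_ofReal μ
    rw [hβ, hβ, star_sub, star_add, star_mul', h4, ← h1, ← h2, ← h3]
  have hβ_bdd : ∀ x : a.domain, |(β x x).re| ≤ (1 + K + |μ| * c⁻¹) * s.quad x := fun x => by
    have h1 : ‖(x : H)‖ ^ 2 ≤ c⁻¹ * s.quad x := by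
      rw [inv_mul_eq_div, le_div_iff₀' hc]; exact h x
    have h2 : |(a x x).re| ≤ s.quad x := by
      have h3 := hq0 (x + j x)
      have h4 := hq0 (x - j x)
      rw [hsum] at h3
      rw [hdiff] at h4
      rw [abs_le]
      constructor <;> linarith
    have h3 : (β x x).re = (a x x).re + w.quad x - μ * ‖(x : H)‖ ^ 2 := by
      have h4 : (inner ℂ (x : H) (x : H)).re = ‖(x : H)‖ ^ 2 := inner_self_eq_norm_sq (𝕜 := ℂ) _
      rw [hβ, Complex.sub_re, Complex.add_re, hreal, h4]
      rfl
    have h4 : |μ * ‖(x : H)‖ ^ 2| ≤ |μ| * (c⁻¹ * s.quad x) := by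
      rw [abs_mul, abs_of_nonneg (sq_nonneg ‖(x : H)‖)]
      gcongr
    rw [h3]
    have h5 := abs_sub ((a x x).re + w.quad x) (μ * ‖(x : H)‖ ^ 2)
    have h6 := abs_add_le (a x x).re (w.quad x)
    have h7 := hw_bdd x
    linarith
  have hβ_coer : ∀ y : a.domain, min δ₁ δ₂ * s.quad y ≤ (β (j y) y).re := fun y => by
    have ha' : (a (j y) y).re = s.quad y := congrArg Complex.re (ha_diag y y)
    have hin : (inner ℂ (j y : H) (y : H)).re = (inner ℂ (y : H) (J y)).re := by
      exact inner_re_symm (𝕜 := ℂ) _ _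
    have h3 : (β (j y) y).re = s.quad y - μ * (inner ℂ (y : H) (J y)).re := by
      rw [hβ, Complex.sub_re, Complex.add_re, hreal, ha', hwj, hin, add_zero]
    rw [h3]
    have hp := h₁ (y + j y) ⟨y, rfl⟩
    have hm := h₂ (y - j y) ⟨y, rfl⟩
    have hp' : ‖((y + j y : a.domain) : H)‖ ^ 2
        = 2 * ‖(y : H)‖ ^ 2 + 2 * (inner ℂ (y : H) (J y)).re := by
      have := norm_add_sq (𝕜 := ℂ) (y : H) (J y)
      rw [hJnorm] at this
      exact this.trans (by simp only [RCLike.re_eq_complex_re]; ring)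
    have hm' : ‖((y - j y : a.domain) : H)‖ ^ 2
        = 2 * ‖(y : H)‖ ^ 2 - 2 * (inner ℂ (y : H) (J y)).re := by
      have := norm_sub_sq (𝕜 := ℂ) (y : H) (J y)
      rw [hJnorm] at this
      exact this.trans (by simp only [RCLike.re_eq_complex_re]; ring)
    have e1 : μ * ‖((y + j y : a.domain) : H)‖ ^ 2 ≤ (1 - min δ₁ δ₂) * s.quad (y + j y) :=
      hp.trans (mul_le_mul_of_nonneg_right (by linarith [min_le_left δ₁ δ₂]) (hq0 _))
    have e2 : -μ * ‖((y - j y : a.domain) : H)‖ ^ 2 ≤ (1 - min δ₁ δ₂) * s.quad (y - j y) :=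
      hm.trans (mul_le_mul_of_nonneg_right (by linarith [min_le_right δ₁ δ₂]) (hq0 _))
    rw [hp', hsum] at e1
    rw [hm', hdiff] at e2
    linarith
  exact s.exists_resolvent haJ_pos haJ_closed j hjj hquadj β hβ_symm hβ_bdd (lt_min hδ₁ hδ₂) hβ_coer

end SesqForm

theorem theorem2p3 {H : Type*} [NormedAddCommGroup H] [InnerProductSpace ℂ H] [CompleteSpace H]
    (a : SesqForm H) (ha_dense : Dense (a.domain : Set H)) (ha_symm : a.IsSymmetric)
    (J : H →L[ℂ] H) (hJ_sa : IsSelfAdjoint J) (hJ_inv : J ∘L J = ContinuousLinearMap.id ℂ H)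
    (hJ : a.domain.map (J : H →ₗ[ℂ] H) = a.domain)
    (ha_diag : a.IsDiagonal J hJ)
    (haJ_pos : (a.twist J hJ).IsPositiveDefinite)
    (haJ_closed : (a.twist J hJ).IsClosed)
    (mp mm : EReal)
    (hmp : mp = (a.twist J hJ).lowerBound
      (LinearMap.range ((ContinuousLinearMap.id ℂ H + J : H →L[ℂ] H) : H →ₗ[ℂ] H)))
    (hmm : mm = (a.twist J hJ).lowerBound
      (LinearMap.range ((ContinuousLinearMap.id ℂ H - J : H →L[ℂ] H) : H →ₗ[ℂ] H)))
    (v : SesqForm H) (hv_symm : v.IsSymmetric) (hav : a.domain ≤ v.domain)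
    (hv_off : (v.restrict a.domain hav).IsOffDiagonal J hJ)
    (hv_bdd : BddAbove {r : ℝ | ∃ x : a.domain, x ≠ 0 ∧
      r = |(v.restrict a.domain hav).quad x| / (a.twist J hJ).quad x}) :
    (a.perturb v hav).IsSymmetric ∧
    (∃! B : H →ₗ.[ℂ] H, IsSelfAdjoint B ∧ (a.perturb v hav).IsRepresentedBy B) ∧
    (∀ B : H →ₗ.[ℂ] H, IsSelfAdjoint B → (a.perturb v hav).IsRepresentedBy B →
      B.IsBoundedlyInvertible ∧
      (-mm < 0 ∧ 0 < mp) ∧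
      ∀ μ : ℝ, -mm < (μ : EReal) → (μ : EReal) < mp → (μ : ℂ) ∈ B.resolventSet) := by
  subst hmp hmm
  have hb := ha_symm.perturb hv_symm hav
  set b := a.perturb v hav with hb_def
  have hp := haJ_pos.lowerBound_pos
    (LinearMap.range ((ContinuousLinearMap.id ℂ H + J : H →L[ℂ] H) : H →ₗ[ℂ] H))
  have hm := haJ_pos.lowerBound_pos
    (LinearMap.range ((ContinuousLinearMap.id ℂ H - J : H →L[ℂ] H) : H →ₗ[ℂ] H))
  obtain ⟨R, hRmem, hR⟩ := SesqForm.exists_resolvent_perturb ha_symm hJ_sa hJ_inv hJ ha_diag haJ_pos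
    haJ_closed hv_symm hav hv_off hv_bdd (μ := 0) (by simpa using hp) (by simpa using hm)
  have hR' : ∀ (y : a.domain) f, (∀ x : a.domain, b x y = inner ℂ (x : H) f) ↔ (y : H) = R f := by
    intro y f
    rw [← hR]
    refine forall_congr' fun x => ?_
    rw [Complex.ofReal_zero, zero_mul, sub_zero]
  have hbR : ∀ (x : a.domain) f, b x ⟨R f, hRmem f⟩ = inner ℂ (x : H) f := fun x f =>
    (hR' ⟨R f, hRmem f⟩ f).2 rfl x
  obtain ⟨B, hB_sa, hB⟩ := exists_isSelfAdjoint_inverse R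
    (fun f g => by
      have h1 := hbR ⟨R f, hRmem f⟩ g
      have h2 := hbR ⟨R g, hRmem g⟩ f
      have h3 := hb ⟨R f, hRmem f⟩ ⟨R g, hRmem g⟩
      exact h1.symm.trans (h3.trans ((congrArg star h2).trans (inner_conj_symm _ _))))
    (fun f hf => by
      refine ha_dense.eq_zero_of_inner_right ℂ fun x hx => ?_
      have h1 := (hR' 0 f).2 (by rw [hf]; rfl) ⟨x, hx⟩
      exact h1.symm.trans (map_zero (b.form _)))
  have hB_rep : b.IsRepresentedBy B := by
    refine ⟨fun y hy => ?_, fun x y => ?_⟩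
    · have h1 := (hB y _).1 ⟨hy, rfl⟩
      rw [h1]
      exact hRmem _
    · exact (hR' _ (B y)).2 ((hB y _).1 ⟨y.2, rfl⟩) x
  have hB_unique : ∀ B' : H →ₗ.[ℂ] H, IsSelfAdjoint B' → b.IsRepresentedBy B' → B' = B := by
    rintro B' hB' ⟨hdom, hrep⟩
    have key : ∀ y : B'.domain, ∃ h : (y : H) ∈ B.domain, B ⟨y, h⟩ = B' y := fun y =>
      (hB y _).2 ((hR' ⟨y, hdom y.2⟩ _).1 fun x => hrep x y)
    refine LinearPMap.eq_of_le_of_isSelfAdjoint hB' hB_sa ⟨fun y hy => (key ⟨y, hy⟩).1, ?_⟩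
    rintro y ⟨z, hz⟩ hyz
    obtain ⟨h1, h2⟩ := key y
    rw [← h2]
    congr 1
    exact Subtype.ext hyz
  refine ⟨hb, ⟨B, ⟨hB_sa, hB_rep⟩, fun B' h => hB_unique B' h.1 h.2⟩, fun B' h1 h2 => ?_⟩
  obtain rfl := hB_unique B' h1 h2
  refine ⟨⟨R, fun x => (hB _ _).2 rfl, fun y => ((hB y _).1 ⟨y.2, rfl⟩).symm⟩,
    ⟨by rwa [EReal.neg_lt_zero], hp⟩, fun μ hμm hμp => ?_⟩
  obtain ⟨S, hSmem, hS⟩ := SesqForm.exists_resolvent_perturb ha_symm hJ_sa hJ_inv hJ ha_diag haJ_pos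
    haJ_closed hv_symm hav hv_off hv_bdd hμp
    (by rw [EReal.coe_neg]; exact EReal.neg_lt_comm.1 hμm)
  refine ⟨S, fun f => ?_, fun y => ?_⟩
  · obtain ⟨h, hf⟩ := (hB (S f) (f + (μ : ℂ) • S f)).2 ((hR' ⟨S f, hSmem f⟩ _).1 fun x => by
      rw [inner_add_right, inner_smul_right, ← (hS ⟨S f, hSmem f⟩ f).2 rfl x]
      ring)
    exact ⟨h, by rw [hf, add_sub_cancel_right]⟩
  · obtain ⟨hdom, hrep⟩ := h2
    refine ((hS ⟨y, hdom y.2⟩ _).1 fun x => ?_).symm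
    rw [inner_sub_right, inner_smul_right, ← hrep x y]
    rfl
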